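/- All groups are abelian. A *rank-1 group* is a torsion-free group of rank one. A *type* is an equivalence class of sequences $(t_p)_{p\in\Pi}$, indexed by the set $\Pi$ of all primes, with $t_p\in\mathbb{N}\cup\{\infty\}$ (where $0\in\mathbb{N}$); two sequences are equivalent if they differ in only finitely many entries and both are finite wherever they differ. The type $t(T)$ of a rank-1 group $T$ is the class of the sequence of $p$-heights of any nonzero element of $T$. Types are ordered by $\tau\le\rho$ if they have representatives with $t_p\le r_p$ for all $p$. For a group $T$ let $T^\perp=\{X \mid \mathrm{Ext}(T,X)=0\}$. **Proposition 1.8.** Let $T$ and $R$ be rank-1 groups with types $t(T)=\tau<\rho=t(R)$, represented by sequences $(t_p)_{p\in\Pi}$ and $(r_p)_{p\in\Pi}$, respectively, with $t_p\le r_p$ for all primes $p$. Suppose that * (2b) there is an infinite set $P$ of primes such that $0<t_p<r_p<\infty$ for all $p\in P$, but that neither of the following holds: * (1) there is a prime $q$ with $t_q<\infty$ and $r_q=\infty$; * (2a) there is an infinite set $P$ of primes such that $t_p=0$ and $0\neq r_p<\infty$ for all $p\in P$. Let $\mathcal{F}$ denote the class of all torsion-free groups of finite rank. Then $$T^\perp\cap\mathcal{F}=R^\perp\cap\mathcal{F}.$$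 Moreover, every group $G$ that belongs to exactly one of $T^\perp$ and $R^\perp$ has infinite (torsion-free) rank. -/

import Mathlib

open CategoryTheory

universe u

namespace RationalGroups

/-- The `p`-height of `x`: the supremum in `ℕ ∪ {∞}` of all `n` such that `x ∈ pⁿ G`. -/
noncomputable def pHeight {G : Type u} [AddCommGroup G] (p : ℕ) (x : G) : ℕ∞ :=
  ⨆ n ∈ {n : ℕ | ∃ y : G, p ^ n • y = x}, (n : ℕ∞)

/-- Sequences `(t_p)` indexed by the primes, with entries in `ℕ ∪ {∞}`. -/
abbrev Characteristic : Type := Nat.Primes → ℕ∞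

/-- The characteristic of an element: the sequence of all its `p`-heights. -/
noncomputable def characteristic {G : Type u} [AddCommGroup G] (x : G) : Characteristic :=
  fun p => pHeight (p : ℕ) x

/-- Two sequences are equivalent if they differ in only finitely many entries, and
are both finite wherever they differ. -/
def Characteristic.Equivalent (a b : Characteristic) : Prop :=
  {p | a p ≠ b p}.Finite ∧ ∀ p, a p ≠ b p → a p ≠ ⊤ ∧ b p ≠ ⊤

theorem Characteristic.equivalent_equivalence :
    Equivalence Characteristic.Equivalent where
  refl a := ⟨by simp, fun p h => absurd rfl h⟩
  symm {a b} h := by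
    refine ⟨?_, fun p hp => (h.2 p hp.symm).symm⟩
    simpa only [ne_comm] using h.1
  trans {a b c} h h' := by
    refine ⟨(h.1.union h'.1).subset ?_, ?_⟩
    · intro p hp
      by_cases hab : a p = b p
      · right
        show b p ≠ c p
        rw [← hab]
        exact hp
      · exact Or.inl hab
    · intro p hp
      have h1 := h.2 p
      have h2 := h'.2 p
      grind

instance Characteristic.setoid : Setoid Characteristic :=
  ⟨Characteristic.Equivalent, Characteristic.equivalent_equivalence⟩

/-- A type is an equivalence class of sequences. -/
def GroupType : Type := Quotient Characteristic.setoid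

/-- The type represented by a sequence. -/
def GroupType.mk (a : Characteristic) : GroupType := Quotient.mk Characteristic.setoid a

theorem GroupType.mk_eq_mk {a b : Characteristic} :
    GroupType.mk a = GroupType.mk b ↔ a.Equivalent b :=
  Quotient.eq (r := Characteristic.setoid)

/-- `τ ≤ ρ` if the types have representatives with `t_p ≤ r_p` for all primes `p`;
`τ < ρ` means `τ ≤ ρ` and not `ρ ≤ τ`. -/
instance : PartialOrder GroupType where
  le τ ρ := ∃ t r : Characteristic, GroupType.mk t = τ ∧ GroupType.mk r = ρ ∧ ∀ p, t p ≤ r p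
  le_refl τ := by
    obtain ⟨t, rfl⟩ := Quotient.exists_rep τ
    exact ⟨t, t, rfl, rfl, fun _ => le_rfl⟩
  le_trans := by
    rintro _ _ _ ⟨a, b, rfl, rfl, hab⟩ ⟨b', c, hb, rfl, hbc⟩
    rw [GroupType.mk_eq_mk] at hb
    refine ⟨fun p => min (a p) (c p), c, ?_, rfl, fun p => min_le_right _ _⟩
    rw [GroupType.mk_eq_mk]
    have key : ∀ p, min (a p) (c p) ≠ a p → b' p ≠ b p ∧ c p < a p := by
      intro p hp
      have hca : c p < a p := by
        by_contra hcon
        exact hp (min_eq_left (not_lt.mp hcon))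
      exact ⟨(((hbc p).trans_lt hca).trans_le (hab p)).ne, hca⟩
    refine ⟨hb.1.subset fun p hp => (key p hp).1, fun p hp => ?_⟩
    obtain ⟨h1, h2⟩ := key p hp
    have ha : a p ≠ ⊤ := ne_top_of_le_ne_top (hb.2 p h1).2 (hab p)
    exact ⟨ne_top_of_le_ne_top ha (min_le_left _ _), ha⟩
  le_antisymm := by
    rintro _ _ ⟨a, b, rfl, rfl, hab⟩ ⟨b', a', hb, ha, hba⟩
    rw [GroupType.mk_eq_mk] at hb ha
    rw [GroupType.mk_eq_mk]
    have key : ∀ p, a p ≠ b p → a' p ≠ a p ∨ b' p ≠ b p := by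
      intro p hp
      by_contra! hcon
      have := hba p
      rw [hcon.1, hcon.2] at this
      exact hp (le_antisymm (hab p) this)
    refine ⟨(ha.1.union hb.1).subset fun p hp => key p hp, fun p hp => ?_⟩
    have hlt : a p < b p := lt_of_le_of_ne (hab p) hp
    refine ⟨hlt.ne_top, ?_⟩
    rcases key p hp with h | h
    · intro hbt
      have hb' : b' p = ⊤ := by
        by_contra hne
        exact (hb.2 p (by rw [hbt]; exact hne)).2 hbt
      exact (ha.2 p h).1 (top_le_iff.mp (hb' ▸ hba p))
    · exact (hb.2 p h).2

/-- Rank-1 groups: torsion-free abelian groups of rank one. -/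
structure IsRankOne (T : Type u) [AddCommGroup T] : Prop where
  torsionFree : IsAddTorsionFree T
  rank_eq : Module.rank ℤ T = 1

theorem IsRankOne.exists_ne_zero {T : Type u} [AddCommGroup T] (hT : IsRankOne T) :
    ∃ x : T, x ≠ 0 := by
  by_contra! h
  have : Subsingleton T := ⟨fun a b => by rw [h a, h b]⟩
  have h1 := hT.rank_eq
  rw [rank_subsingleton'] at h1
  exact zero_ne_one h1

/-- The type `t(T)` of a rank-1 group `T`: the class of the characteristic of a nonzero element
(it does not depend on the element, see `typeOf_eq`). -/
noncomputable def typeOf (T : Type u) [AddCommGroup T] (hT : IsRankOne T) : GroupType :=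
  GroupType.mk (characteristic (Classical.choose hT.exists_ne_zero))

theorem pow_dvd_of_le_pHeight {G : Type u} [AddCommGroup G] {p n : ℕ} {x : G}
    (h : (n : ℕ∞) ≤ pHeight p x) : ∃ y : G, p ^ n • y = x := by
  by_contra hn
  rcases Nat.eq_zero_or_pos n with rfl | hpos
  · exact hn ⟨x, by simp⟩
  have : pHeight p x ≤ ((n - 1 : ℕ) : ℕ∞) := by
    refine iSup₂_le fun m ⟨y, hy⟩ => ?_
    have : m < n := by
      by_contra hmn
      refine hn ⟨p ^ (m - n) • y, ?_⟩
      rw [smul_smul, ← pow_add, Nat.add_sub_cancel' (not_lt.mp hmn), hy]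
    exact_mod_cast Nat.le_sub_one_of_lt this
  have := h.trans this
  have : n ≤ n - 1 := by exact_mod_cast this
  omega

theorem le_pHeight {G : Type u} [AddCommGroup G] {p n : ℕ} {x : G}
    (h : ∃ y : G, p ^ n • y = x) : (n : ℕ∞) ≤ pHeight p x :=
  le_iSup₂ (f := fun (n : ℕ) (_ : n ∈ {n : ℕ | ∃ y : G, p ^ n • y = x}) => (n : ℕ∞)) n h

theorem characteristic_smul_equivalent {G : Type u} [AddCommGroup G] [IsAddTorsionFree G]
    (x : G) {m : ℤ} (hm : m ≠ 0) :
    (characteristic (m • x)).Equivalent (characteristic x) := by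
  have hle : ∀ p : Nat.Primes, pHeight (p : ℕ) x ≤ pHeight (p : ℕ) (m • x) := by
    intro p
    refine iSup₂_le fun n ⟨y, hy⟩ => le_pHeight ⟨m • y, ?_⟩
    rw [smul_comm, hy]
  have hge : ∀ p : Nat.Primes, ∀ v : ℕ, ∀ m' : ℤ, m = (p : ℤ) ^ v * m' → ¬ (p : ℤ) ∣ m' →
      pHeight (p : ℕ) (m • x) ≤ pHeight (p : ℕ) x + v := by
    intro p v m' hmm hpm
    refine iSup₂_le fun n ⟨y, hy⟩ => ?_
    rcases le_total n v with hnv | hnv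
    · exact le_trans (by exact_mod_cast hnv) le_add_self
    · obtain ⟨k, rfl⟩ := Nat.exists_eq_add_of_le hnv
      have hp0 : ((p : ℕ) : ℕ) ^ v ≠ 0 := pow_ne_zero _ p.2.ne_zero
      have h1 : (p : ℕ) ^ k • y = m' • x := by
        apply IsAddTorsionFree.nsmul_right_injective hp0
        show (p : ℕ) ^ v • ((p : ℕ) ^ k • y) = (p : ℕ) ^ v • (m' • x)
        rw [smul_smul, ← pow_add, hy, hmm, mul_smul, ← natCast_zsmul (m' • x)]
        push_cast
        rfl
      have hcop : IsCoprime ((p : ℤ) ^ k) m' :=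
        ((Nat.prime_iff_prime_int.mp p.2).coprime_iff_not_dvd.mpr hpm).pow_left
      obtain ⟨a, b, hab⟩ := hcop
      have h2 : ∃ z : G, (p : ℕ) ^ k • z = x := by
        refine ⟨a • x + b • y, ?_⟩
        have h3 : ((p : ℤ) ^ k) • y = m' • x := by
          rw [← h1, ← natCast_zsmul]
          push_cast
          rfl
        rw [← natCast_zsmul]
        push_cast
        rw [smul_add, smul_comm _ b y, h3, smul_smul, smul_smul, ← add_smul, mul_comm, hab,
          one_smul]
      have h4 := le_pHeight h2
      push_cast
      rw [add_comm]
      gcongr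
  have hfac : ∀ p : Nat.Primes, ∃ (v : ℕ) (m' : ℤ), m = (p : ℤ) ^ v * m' ∧ ¬ (p : ℤ) ∣ m' := by
    intro p
    have hfin : FiniteMultiplicity (p : ℤ) m := by
      refine Int.finiteMultiplicity_iff.mpr ⟨?_, hm⟩
      simpa using p.2.ne_one
    obtain ⟨c, hc, hd⟩ := hfin.exists_eq_pow_mul_and_not_dvd
    exact ⟨_, c, hc, hd⟩
  refine ⟨?_, fun p hp => ?_⟩
  · have hfin : {p : Nat.Primes | (p : ℕ) ∣ m.natAbs}.Finite := by
      refine Set.Finite.of_finite_image (f := fun p : Nat.Primes => (p : ℕ)) ?_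
        Subtype.val_injective.injOn
      refine (Finset.finite_toSet (Nat.divisors m.natAbs)).subset ?_
      rintro _ ⟨p, hp, rfl⟩
      simpa [hm] using hp
    refine hfin.subset fun p hp => ?_
    by_contra hdvd
    refine hp (le_antisymm ?_ (hle p))
    have := hge p 0 m (by simp) (fun h => hdvd (Int.natCast_dvd.mp h))
    rw [Nat.cast_zero, add_zero] at this
    exact this
  · obtain ⟨v, m', h1, h2⟩ := hfac p
    have hg := hge p v m' h1 h2
    have hx : pHeight (p : ℕ) x ≠ ⊤ := by
      intro htop
      have := hle p
      rw [htop, top_le_iff] at this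
      exact hp (this.trans htop.symm)
    refine ⟨ne_top_of_le_ne_top ?_ hg, hx⟩
    simp [hx]

theorem typeOf_eq {T : Type u} [AddCommGroup T] (hT : IsRankOne T) {x : T} (hx : x ≠ 0) :
    typeOf T hT = GroupType.mk (characteristic x) := by
  have := hT.torsionFree
  have hy := Classical.choose_spec hT.exists_ne_zero
  unfold typeOf
  set y := Classical.choose hT.exists_ne_zero
  have hdep : ¬ LinearIndependent ℤ ![x, y] := by
    intro h
    have h1 := h.cardinal_lift_le_rank
    rw [hT.rank_eq] at h1
    simp at h1
  rw [LinearIndependent.pair_iff] at hdep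
  push Not at hdep
  obtain ⟨m, n, hmn, hne⟩ := hdep
  have hm : m ≠ 0 := by
    rintro rfl
    have : n • y = 0 := by simpa using hmn
    rcases smul_eq_zero.mp this with h | h
    · exact hne rfl h
    · exact hy h
  have hn : n ≠ 0 := by
    rintro rfl
    have : m • x = 0 := by simpa using hmn
    rcases smul_eq_zero.mp this with h | h
    · exact hm h
    · exact hx h
  have heq : m • x = (-n) • y := by
    rw [neg_smul]
    exact eq_neg_of_add_eq_zero_left hmn
  have e1 := GroupType.mk_eq_mk.mpr (characteristic_smul_equivalent x hm)
  have e2 := GroupType.mk_eq_mk.mpr (characteristic_smul_equivalent y (neg_ne_zero.mpr hn))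
  rw [← e1, heq, e2]

/-- `T^⊥`: the class of all abelian groups `X` with `Ext(T, X) = 0`. -/
def perp (T : ModuleCat.{u} ℤ) : Set (ModuleCat.{u} ℤ) :=
  {X | Subsingleton (Abelian.Ext T X 1)}

/-- The class of all torsion-free abelian groups of finite rank. -/
def finiteRankTorsionFree : Set (ModuleCat.{u} ℤ) :=
  {G | IsAddTorsionFree G ∧ Module.rank ℤ G < Cardinal.aleph0}

end RationalGroups

/-! Embed `G` in an injective group `D` with quotient `Q`; then `Ext(T, G) = 0` means that every map
`T → Q` lifts to `D`. As `Q` is divisible and `T` embeds in `R`, vanishing for `R` implies vanishing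
for `T`, whatever the rank of `G`.

For the converse let `Ext(T, G) = 0` with `G` of finite rank, and fix `0 ≠ x ∈ T`. Let `S` be the
set of primes that divide `x` but by which `G` is not divisible. Vanishing makes `G → ∏_{p ∈ S}
G/pG` surjective (`LiftsAlong.exists_simultaneous_congruence`), whereas `G` is countable modulo
torsion, so a diagonal argument forces `S` to be finite (`finite_of_simultaneous_congruence`). Since
(1) and (2a) fail, only finitely many primes then matter, and at these the heights are finite and
can be equalised. This gives an embedding `T → R` whose index involves only primes by which `G` is
divisible. Along such an embedding liftability passes from `T` to `R`
(`LiftsAlong.of_divisible_index`). -/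

namespace RationalGroups

/-! ### Vanishing of Ext as a lifting property -/

/-- Every homomorphism `T → Q` lifts along `q : D → Q`. -/
def LiftsAlong (T : Type*) {D Q : Type*} [AddCommGroup T] [AddCommGroup D] [AddCommGroup Q]
    (q : D →ₗ[ℤ] Q) : Prop :=
  ∀ φ : T →ₗ[ℤ] Q, ∃ ψ : T →ₗ[ℤ] D, q ∘ₗ ψ = φ

theorem exists_smul_eq_of_baer {D : Type*} [AddCommGroup D] (hD : Module.Baer ℤ D) {n : ℤ}
    (hn : n ≠ 0) (d : D) : ∃ e : D, n • e = d := by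
  obtain ⟨h, hh⟩ := hD.extension_property (LinearMap.lsmul ℤ ℤ n)
    (LinearMap.lsmul_injective hn) (LinearMap.toSpanSingleton ℤ D d)
  refine ⟨h 1, ?_⟩
  have := LinearMap.congr_fun hh 1
  simpa [← map_zsmul] using this

theorem baer_of_exists_smul_eq {D : Type*} [AddCommGroup D]
    (h : ∀ n : ℤ, n ≠ 0 → ∀ d : D, ∃ e : D, n • e = d) : Module.Baer ℤ D := by
  have : DivisibleBy D ℤ := divisibleByOfSMulRightSurj _ _ fun {n} hn d => h n hn d
  exact Module.Baer.of_divisible D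

theorem baer_of_surjective {D Q : Type*} [AddCommGroup D] [AddCommGroup Q] (hD : Module.Baer ℤ D)
    {q : D →ₗ[ℤ] Q} (hq : Function.Surjective q) : Module.Baer ℤ Q := by
  refine baer_of_exists_smul_eq fun n hn x => ?_
  obtain ⟨d, rfl⟩ := hq x
  obtain ⟨e, rfl⟩ := exists_smul_eq_of_baer hD hn d
  exact ⟨q e, (map_zsmul q n e).symm⟩

/-- Exactness of `Hom(T, D) → Hom(T, Q) → Ext(T, G) → Ext(T, D) = 0`. -/
theorem exists_injective_presentation_moduleCat (G : ModuleCat.{u} ℤ) :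
    ∃ (D Q : ModuleCat.{u} ℤ) (q : D →ₗ[ℤ] Q), Function.Surjective q ∧ Module.Baer ℤ D ∧
      Nonempty (G ≃+ LinearMap.ker q) ∧ ∀ T : ModuleCat.{u} ℤ, G ∈ perp T ↔
        ∀ φ : T →ₗ[ℤ] Q, ∃ ψ : T →ₗ[ℤ] D, q ∘ₗ ψ = φ := by
  let D : ModuleCat.{u} ℤ := Injective.under G
  let i : G ⟶ D := Injective.ι G
  let S : ShortComplex (ModuleCat.{u} ℤ) := ShortComplex.mk i (Limits.cokernel.π i) (by simp)
  have hS : S.ShortExact :=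
    { exact := ShortComplex.exact_of_g_is_cokernel _ (Limits.cokernelIsCokernel i) }
  have hex : Function.Exact S.f.hom S.g.hom := by
    have := hS.exact
    rwa [ShortComplex.ShortExact.moduleCat_exact_iff_function_exact] at this
  have hinj : Function.Injective S.f.hom := hS.moduleCat_injective_f
  refine ⟨D, S.X₃, S.g.hom, hS.moduleCat_surjective_g, ?_, ?_, ?_⟩
  · have : Module.Injective ℤ D := (Module.injective_iff_injective_object ℤ D).mpr
      (inferInstanceAs (Injective (Injective.under G)))
    exact Module.Baer.of_injective this
  · refine ⟨AddEquiv.ofBijective (AddMonoidHom.mk' (fun x : G => (⟨S.f.hom x, ?_⟩ :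
      LinearMap.ker S.g.hom)) fun x y => Subtype.ext (map_add S.f.hom x y)) ⟨?_, ?_⟩⟩
    · exact (hex _).mpr ⟨x, rfl⟩
    · exact fun x y h => hinj (congrArg Subtype.val h)
    · rintro ⟨d, hd⟩
      obtain ⟨x, rfl⟩ := (hex d).mp hd
      exact ⟨x, rfl⟩
  · intro T
    have : Injective S.X₂ := inferInstanceAs (Injective (Injective.under G))
    constructor
    · intro (h : Subsingleton (Abelian.Ext T G 1)) φ
      obtain ⟨x, hx⟩ := Abelian.Ext.covariant_sequence_exact₃ T hS
        (Abelian.Ext.mk₀ (ModuleCat.ofHom φ : T ⟶ S.X₃)) (zero_add 1)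
        (Subsingleton.elim (α := Abelian.Ext T G 1) _ _)
      obtain ⟨ψ, rfl⟩ := (Abelian.Ext.mk₀_bijective T S.X₂).2 x
      rw [Abelian.Ext.mk₀_comp_mk₀] at hx
      have := (Abelian.Ext.mk₀_bijective T S.X₃).1 hx
      exact ⟨ψ.hom, by rw [← ModuleCat.hom_comp, this]; rfl⟩
    · intro h
      refine subsingleton_of_forall_eq (α := Abelian.Ext T G 1) 0 fun e => ?_
      obtain ⟨x, hx⟩ := Abelian.Ext.covariant_sequence_exact₁ T hS (n₁ := 1) e
        (Abelian.Ext.eq_zero_of_injective _) (zero_add 1)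
      obtain ⟨φ, rfl⟩ := (Abelian.Ext.mk₀_bijective T S.X₃).2 x
      obtain ⟨ψ, hψ⟩ := h φ.hom
      have hφ : φ = ModuleCat.ofHom ψ ≫ S.g := by
        ext1
        rw [← hψ]
        rfl
      rw [← hx, hφ, ← Abelian.Ext.mk₀_comp_mk₀, Abelian.Ext.comp_assoc_of_second_deg_zero,
        hS.comp_extClass, Abelian.Ext.comp_zero]

/-- `Ext(T, G)` vanishes if and only if every homomorphism from `T` to the cokernel of an
embedding of `G` into an injective group lifts. -/
theorem exists_injective_presentation (G : ModuleCat.{u} ℤ) :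
    ∃ (D Q : Type u) (_ : AddCommGroup D) (_ : AddCommGroup Q) (q : D →ₗ[ℤ] Q),
      Function.Surjective q ∧ Module.Baer ℤ D ∧ Nonempty (G ≃+ LinearMap.ker q) ∧
      ∀ T : ModuleCat.{u} ℤ, G ∈ perp T ↔ LiftsAlong T q := by
  obtain ⟨@⟨D, gD, iD⟩, @⟨Q, gQ, iQ⟩, q, hq, hD, e, h⟩ :=
    exists_injective_presentation_moduleCat G
  -- A group has only one `ℤ`-module structure, so the bundled ones may be replaced by the canonical
  -- ones.
  obtain rfl : iD = AddCommGroup.toIntModule D := Subsingleton.elim _ _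
  obtain rfl : iQ = AddCommGroup.toIntModule Q := Subsingleton.elim _ _
  refine ⟨D, Q, _, _, q, hq, hD, e, ?_⟩
  rintro @⟨T, gT, iT⟩
  obtain rfl : iT = AddCommGroup.toIntModule T := Subsingleton.elim _ _
  exact h _

theorem LiftsAlong.of_injective {T R D Q : Type*} [AddCommGroup T] [AddCommGroup R]
    [AddCommGroup D] [AddCommGroup Q] {q : D →ₗ[ℤ] Q} (hQ : Module.Baer ℤ Q)
    {f : T →ₗ[ℤ] R} (hf : Function.Injective f) (h : LiftsAlong R q) : LiftsAlong T q := by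
  intro φ
  obtain ⟨φ', rfl⟩ := hQ.extension_property f hf φ
  obtain ⟨ψ, rfl⟩ := h φ'
  exact ⟨ψ ∘ₗ f, rfl⟩

/-! ### Lifting when the index divides `G` -/

/-- The group `G` is `n`-divisible. -/
def IsDivisibleBy (G : Type*) [AddCommGroup G] (n : ℕ) : Prop := ∀ g : G, ∃ h : G, n • h = g

theorem IsDivisibleBy.mul {G : Type*} [AddCommGroup G] {m n : ℕ} (hm : IsDivisibleBy G m)
    (hn : IsDivisibleBy G n) : IsDivisibleBy G (m * n) := by
  intro g
  obtain ⟨h, rfl⟩ := hm g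
  obtain ⟨k, rfl⟩ := hn h
  exact ⟨k, mul_smul _ _ _⟩

theorem IsDivisibleBy.of_dvd {G : Type*} [AddCommGroup G] {m n : ℕ} (hn : IsDivisibleBy G n)
    (hmn : m ∣ n) : IsDivisibleBy G m := by
  intro g
  obtain ⟨h, rfl⟩ := hn g
  obtain ⟨k, rfl⟩ := hmn
  exact ⟨k • h, (mul_smul _ _ _).symm⟩

/-- The elements of `G` whose order is a number by which `G` is divisible. -/
def divisibleTorsion (G : Type*) [AddCommGroup G] : Submodule ℤ G where
  carrier := {g | ∃ n : ℕ, n ≠ 0 ∧ IsDivisibleBy G n ∧ n • g = 0}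
  zero_mem' := ⟨1, one_ne_zero, fun g => ⟨g, one_smul _ g⟩, smul_zero _⟩
  add_mem' := by
    rintro a b ⟨m, hm, hdm, ha⟩ ⟨n, hn, hdn, hb⟩
    refine ⟨m * n, mul_ne_zero hm hn, hdm.mul hdn, ?_⟩
    rw [smul_add, mul_smul m n b, hb, mul_comm, mul_smul, ha, smul_zero, smul_zero, add_zero]
  smul_mem' := by
    rintro c a ⟨m, hm, hdm, ha⟩
    exact ⟨m, hm, hdm, by rw [smul_comm, ha, smul_zero]⟩

/-- One prime `p` at a time: if `G` is `p`-divisible, a `p`-th root in `G` of an element killed by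
`n` is killed by `np`, which is again admissible. Otherwise `p ∤ n`, and `p` acts invertibly on the
element. -/
theorem divisibleTorsion_baer (G : Type*) [AddCommGroup G] :
    Module.Baer ℤ (divisibleTorsion G) := by
  have key : ∀ m : ℕ, m ≠ 0 → IsDivisibleBy (divisibleTorsion G) m := by
    intro m
    induction m using induction_on_primes with
    | zero => exact fun h => absurd rfl h
    | one => exact fun _ g => ⟨g, one_smul _ g⟩
    | prime_mul p a hp ih =>
      intro hpa
      refine IsDivisibleBy.mul ?_ (ih (right_ne_zero_of_mul hpa))
      rintro ⟨g, n, hn, hdn, hg⟩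
      by_cases hpG : IsDivisibleBy G p
      · obtain ⟨h, rfl⟩ := hpG g
        exact ⟨⟨h, n * p, mul_ne_zero hn hp.ne_zero, hdn.mul hpG, by rw [mul_smul, hg]⟩, rfl⟩
      · have hcop : IsCoprime (p : ℤ) (n : ℤ) := Nat.isCoprime_iff_coprime.mpr
          ((Nat.Prime.coprime_iff_not_dvd hp).mpr fun h => hpG (hdn.of_dvd h))
        obtain ⟨u, v, huv⟩ := hcop
        refine ⟨⟨u • g, Submodule.smul_mem _ u ⟨n, hn, hdn, hg⟩⟩, Subtype.ext ?_⟩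
        show p • u • g = g
        have hg' : (n : ℤ) • g = 0 := by rw [natCast_zsmul, hg]
        calc p • u • g = (u * p) • g + v • ((n : ℤ) • g) := by
              rw [hg', smul_zero, add_zero, mul_smul, natCast_zsmul, smul_comm]
          _ = g := by rw [smul_smul, ← add_smul, huv, one_smul]
  refine baer_of_exists_smul_eq fun n hn d => ?_
  obtain ⟨e, he⟩ := key n.natAbs (Int.natAbs_ne_zero.mpr hn) d
  rcases Int.natAbs_eq n with h | h
  · exact ⟨e, by rw [h, natCast_zsmul, he]⟩
  · exact ⟨-e, by rw [h, neg_smul_neg, natCast_zsmul, he]⟩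

/-- A homomorphism into `D ⧸ G` lifts if each of its values is annihilated by a number by which
`G` is divisible. -/
theorem exists_lift_of_divisible_order {R D Q : Type*} [AddCommGroup R] [AddCommGroup D]
    [AddCommGroup Q] {q : D →ₗ[ℤ] Q} (hq : Function.Surjective q) (χ : R →ₗ[ℤ] Q)
    (hχ : ∀ b : R, ∃ n : ℕ, n ≠ 0 ∧ IsDivisibleBy (LinearMap.ker q) n ∧ n • χ b = 0) :
    ∃ ψ : R →ₗ[ℤ] D, q ∘ₗ ψ = χ := by
  let ι : divisibleTorsion (LinearMap.ker q) →ₗ[ℤ] D :=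
    (LinearMap.ker q).subtype ∘ₗ (divisibleTorsion (LinearMap.ker q)).subtype
  have hι : Function.Injective ι :=
    (Submodule.injective_subtype _).comp (Submodule.injective_subtype _)
  obtain ⟨π, hπ⟩ := (divisibleTorsion_baer (LinearMap.ker q)).extension_property ι hι LinearMap.id
  have hπι : ∀ s, π (ι s) = s := fun s => LinearMap.congr_fun hπ s
  have hqι : ∀ s, q (ι s) = 0 := fun s => s.1.2
  -- Correcting a preimage by an element of `G = ker q` gives it finite admissible order. Such
  -- preimages are unique modulo `divisibleTorsion`, a direct summand of `D`; removing the component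
  -- in this summand makes the choice additive.
  have hex : ∀ b : R, ∃ d : D, q d = χ b ∧
      ∃ n : ℕ, n ≠ 0 ∧ IsDivisibleBy (LinearMap.ker q) n ∧ n • d = 0 := by
    intro b
    obtain ⟨n, hn, hdn, hb⟩ := hχ b
    obtain ⟨d, hd⟩ := hq (χ b)
    obtain ⟨⟨h, hh⟩, hhd⟩ := hdn ⟨n • d, by rw [LinearMap.mem_ker, map_nsmul, hd, hb]⟩
    have hhd' : n • h = n • d := congrArg Subtype.val hhd
    refine ⟨d - h, by rw [map_sub, LinearMap.mem_ker.mp hh, sub_zero, hd], n, hn, hdn, ?_⟩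
    rw [smul_sub, hhd', sub_self]
  choose d hd n hn hdn hnd using hex
  refine ⟨AddMonoidHom.toIntLinearMap (AddMonoidHom.mk' (fun b => d b - ι (π (d b))) ?_), ?_⟩
  · intro a b
    have hmem : d (a + b) - (d a + d b) ∈ LinearMap.ker q := by
      rw [LinearMap.mem_ker, map_sub, map_add, hd, hd, hd, map_add, sub_self]
    have hs : (⟨_, hmem⟩ : LinearMap.ker q) ∈ divisibleTorsion (LinearMap.ker q) := by
      refine ⟨n (a + b) * (n a * n b), mul_ne_zero (hn _) (mul_ne_zero (hn _) (hn _)),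
        (hdn _).mul ((hdn _).mul (hdn _)), Subtype.ext ?_⟩
      show (n (a + b) * (n a * n b)) • (d (a + b) - (d a + d b)) = 0
      have e1 : (n (a + b) * (n a * n b)) • d (a + b) = 0 := by
        rw [mul_comm, mul_smul, hnd, smul_zero]
      have e2 : (n (a + b) * (n a * n b)) • d a = 0 := by
        rw [mul_left_comm, mul_comm, mul_smul, hnd, smul_zero]
      have e3 : (n (a + b) * (n a * n b)) • d b = 0 := by
        rw [← mul_assoc, mul_smul, hnd, smul_zero]
      rw [smul_sub, smul_add, e1, e2, e3, add_zero, sub_zero]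
    have hz := congrArg ι (hπι ⟨⟨_, hmem⟩, hs⟩)
    have hz' : ι ⟨⟨_, hmem⟩, hs⟩ = d (a + b) - (d a + d b) := rfl
    rw [hz', map_sub, map_sub, map_add, map_add] at hz
    have := eq_add_of_sub_eq hz
    rw [this]
    abel
  · ext b
    show q (d b - ι (π (d b))) = χ b
    rw [map_sub, hqι, sub_zero, hd]

/-- Lift on `T` and extend the lift to `R` by injectivity of `D`. The error vanishes on the image of
`T`, so its values have admissible orders and it lifts too. -/
theorem LiftsAlong.of_divisible_index {T R D Q : Type*} [AddCommGroup T] [AddCommGroup R]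
    [AddCommGroup D] [AddCommGroup Q] {q : D →ₗ[ℤ] Q} (hq : Function.Surjective q)
    (hD : Module.Baer ℤ D) {f : T →ₗ[ℤ] R} (hf : Function.Injective f)
    (hfR : ∀ b : R, ∃ n : ℕ, n ≠ 0 ∧ IsDivisibleBy (LinearMap.ker q) n ∧ ∃ a : T, f a = n • b)
    (h : LiftsAlong T q) : LiftsAlong R q := by
  intro φ
  obtain ⟨ψ, hψ⟩ := h (φ ∘ₗ f)
  obtain ⟨ψ', rfl⟩ := hD.extension_property f hf ψ
  obtain ⟨θ, hθ⟩ := exists_lift_of_divisible_order hq (φ - q ∘ₗ ψ') fun b => by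
    obtain ⟨n, hn, hdn, a, ha⟩ := hfR b
    refine ⟨n, hn, hdn, ?_⟩
    rw [← map_nsmul, ← ha]
    have := LinearMap.congr_fun hψ a
    simp only [LinearMap.comp_apply] at this
    simp [this]
  exact ⟨θ + ψ', by rw [LinearMap.comp_add, hθ, sub_add_cancel]⟩

/-! ### Divisibility and heights -/

theorem exists_mul_smul_eq_of_coprime {G : Type*} [AddCommGroup G] {a b : ℕ} (hab : a.Coprime b)
    {x : G} (ha : ∃ y : G, a • y = x) (hb : ∃ y : G, b • y = x) : ∃ y : G, (a * b) • y = x := by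
  obtain ⟨y, hy⟩ := ha
  obtain ⟨z, hz⟩ := hb
  obtain ⟨u, v, huv⟩ := Nat.isCoprime_iff_coprime.mpr hab
  refine ⟨u • z + v • y, ?_⟩
  rw [smul_add, smul_comm _ u, smul_comm _ v, mul_smul, hz, mul_comm, mul_smul, hy,
    ← natCast_zsmul, ← natCast_zsmul, smul_smul, smul_smul, ← add_smul, huv, one_smul]

/-- Divisibility can be transferred prime power by prime power. -/
theorem exists_smul_eq_of_prime_pow {G H : Type*} [AddCommGroup G] [AddCommGroup H] {x : G} {y : H}
    {n : ℕ} (hn : n ≠ 0)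
    (h : ∀ p k : ℕ, p.Prime → p ∣ n → (∃ z : G, p ^ k • z = x) → ∃ z : H, p ^ k • z = y)
    (hx : ∃ z : G, n • z = x) : ∃ z : H, n • z = y := by
  induction n using Nat.recOnPosPrimePosCoprime with
  | zero => exact absurd rfl hn
  | one => exact ⟨y, one_smul _ y⟩
  | prime_pow p k hp hk => exact h p k hp (dvd_pow_self p hk.ne') hx
  | coprime a b ha hb hab iha ihb =>
    obtain ⟨z, rfl⟩ := hx
    refine exists_mul_smul_eq_of_coprime hab
      (iha (by omega) (fun p k hp hpa => h p k hp (hpa.mul_right b)) ⟨b • z, ?_⟩)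
      (ihb (by omega) (fun p k hp hpb => h p k hp (hpb.mul_left a)) ⟨a • z, ?_⟩)
    · rw [mul_smul]
    · rw [mul_comm, mul_smul]

theorem natCast_le_pHeight_iff {G : Type u} [AddCommGroup G] {p n : ℕ} {x : G} :
    (n : ℕ∞) ≤ pHeight p x ↔ ∃ y : G, p ^ n • y = x :=
  ⟨pow_dvd_of_le_pHeight, le_pHeight⟩

theorem exists_smul_eq_of_coprime_smul {G : Type*} [AddCommGroup G] {a b : ℕ} (hab : a.Coprime b)
    {x : G} (h : ∃ y : G, a • y = b • x) : ∃ y : G, a • y = x := by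
  obtain ⟨y, hy⟩ := h
  obtain ⟨u, v, huv⟩ := Nat.isCoprime_iff_coprime.mpr hab
  refine ⟨u • x + v • y, ?_⟩
  rw [smul_add, smul_comm _ u, smul_comm _ v, hy,
    ← natCast_zsmul, ← natCast_zsmul, smul_smul, smul_smul, ← add_smul, huv, one_smul]

/-- Multiplying by `pᵃ m`, where `p ∤ m`, increases the `p`-height by `a`. -/
theorem pHeight_pow_mul_smul {G : Type u} [AddCommGroup G] [IsAddTorsionFree G] {p : ℕ}
    (hp : p.Prime) (a : ℕ) {m : ℕ} (hm : ¬ p ∣ m) (x : G) :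
    pHeight p ((p ^ a * m) • x) = pHeight p x + a := by
  have hcop : ∀ k, (p ^ k).Coprime m := fun k =>
    Nat.Coprime.pow_left k ((Nat.Prime.coprime_iff_not_dvd hp).mpr hm)
  refine ENat.eq_of_forall_natCast_le_iff fun k => ?_
  rw [← tsub_le_iff_right, ← ENat.natCast_sub, natCast_le_pHeight_iff, natCast_le_pHeight_iff]
  constructor
  · rintro ⟨y, hy⟩
    rcases le_total k a with hka | hka
    · exact ⟨x, by rw [Nat.sub_eq_zero_of_le hka, pow_zero, one_smul]⟩
    · refine exists_smul_eq_of_coprime_smul (hcop _) ⟨y, ?_⟩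
      apply IsAddTorsionFree.nsmul_right_injective (pow_ne_zero a hp.ne_zero)
      show p ^ a • p ^ (k - a) • y = p ^ a • m • x
      rw [smul_smul, ← pow_add, Nat.add_sub_cancel' hka, hy, mul_smul]
  · rintro ⟨y, rfl⟩
    -- With truncated subtraction the exponent is `a - k` if `k ≤ a`, and `0` otherwise.
    refine ⟨(p ^ (a + (k - a) - k) * m) • y, ?_⟩
    rw [smul_smul, smul_smul, ← mul_assoc, ← pow_add, mul_right_comm, ← pow_add]
    congr 3
    omega

/-- In a torsion-free group heights can be raised by prescribed amounts at finitely many primes. -/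
theorem exists_ne_zero_pHeight_eq_add {G : Type u} [AddCommGroup G] [IsAddTorsionFree G] {x : G}
    (hx : x ≠ 0) (F : Finset Nat.Primes) (a : Nat.Primes → ℕ) :
    ∃ y : G, y ≠ 0 ∧ (∀ p ∈ F, pHeight p y = pHeight p x + a p) ∧
      ∀ p ∉ F, pHeight p y = pHeight p x := by
  classical
  induction F using Finset.induction_on with
  | empty => exact ⟨x, hx, by simp, fun _ _ => rfl⟩
  | insert l F hl ih =>
    obtain ⟨y, hy, h1, h2⟩ := ih
    have hself : pHeight l ((l : ℕ) ^ a l • y) = pHeight l y + a l := by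
      simpa using pHeight_pow_mul_smul l.2 (a l) (m := 1) l.2.not_dvd_one y
    have hother : ∀ p : Nat.Primes, p ≠ l → pHeight p ((l : ℕ) ^ a l • y) = pHeight p y := by
      intro p hpl
      have hdvd : ¬ (p : ℕ) ∣ (l : ℕ) ^ a l := fun h => hpl (Subtype.ext
        ((Nat.prime_dvd_prime_iff_eq p.2 l.2).mp (p.2.dvd_of_dvd_pow h)))
      simpa using pHeight_pow_mul_smul p.2 0 hdvd y
    refine ⟨(l : ℕ) ^ a l • y, smul_ne_zero (pow_ne_zero _ l.2.ne_zero) hy, ?_, ?_⟩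
    · intro p hp
      rcases Finset.mem_insert.mp hp with rfl | hpF
      · rw [hself, h2 p hl]
      · rw [hother p (fun h => hl (h ▸ hpF)), h1 p hpF]
    · intro p hp
      rw [Finset.mem_insert, not_or] at hp
      rw [hother p hp.1, h2 p hp.2]

/-! ### Embeddings between rank-1 groups -/

theorem IsRankOne.exists_smul_eq_smul {T : Type u} [AddCommGroup T] (hT : IsRankOne T) {x : T}
    (hx : x ≠ 0) (a : T) : ∃ (n : ℕ) (m : ℤ), n ≠ 0 ∧ IsCoprime (n : ℤ) m ∧ n • a = m • x := by
  have := hT.torsionFree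
  have hdep : ¬ LinearIndependent ℤ ![a, x] := by
    intro h
    have h1 := h.cardinal_lift_le_rank
    rw [hT.rank_eq] at h1
    simp at h1
  rw [LinearIndependent.pair_iff] at hdep
  push Not at hdep
  obtain ⟨n, m, hnm, hne⟩ := hdep
  have hn : n ≠ 0 := by
    rintro rfl
    have : m • x = 0 := by simpa using hnm
    exact (smul_eq_zero.mp this).elim (hne rfl) hx
  have heq : n • a = (-m) • x := by
    rw [neg_smul]
    exact eq_neg_of_add_eq_zero_left hnm
  obtain ⟨n', m', hcop, hn', hm'⟩ : ∃ n' m' : ℤ, IsCoprime n' m' ∧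
      n = Int.gcd n (-m) * n' ∧ -m = Int.gcd n (-m) * m' := by
    have hpos : 0 < Int.gcd n (-m) := Int.gcd_pos_of_ne_zero_left _ hn
    refine ⟨n / Int.gcd n (-m), -m / Int.gcd n (-m), ?_,
      (Int.mul_ediv_cancel' (Int.gcd_dvd_left _ _)).symm,
      (Int.mul_ediv_cancel' (Int.gcd_dvd_right _ _)).symm⟩
    exact Int.isCoprime_iff_gcd_eq_one.mpr (Int.gcd_div_gcd_div_gcd hpos)
  have hg : (Int.gcd n (-m) : ℤ) ≠ 0 := fun h => hn (by rw [hn', h, zero_mul])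
  have heq' : n' • a = m' • x := by
    apply smul_right_injective T hg
    show (Int.gcd n (-m) : ℤ) • n' • a = (Int.gcd n (-m) : ℤ) • m' • x
    rw [smul_smul, smul_smul, ← hn', ← hm', heq]
  have hn0 : n' ≠ 0 := by rintro rfl; exact hn (by rw [hn', mul_zero])
  rcases Int.natAbs_eq n' with h | h
  · exact ⟨n'.natAbs, m', Int.natAbs_ne_zero.mpr hn0, h ▸ hcop, by rw [← natCast_zsmul, ← h, heq']⟩
  · refine ⟨n'.natAbs, -m', Int.natAbs_ne_zero.mpr hn0, ?_, ?_⟩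
    · rw [← neg_eq_iff_eq_neg.mpr h]
      exact hcop.neg_neg
    · rw [← natCast_zsmul, ← neg_eq_iff_eq_neg.mpr h, neg_smul, neg_smul, heq']

theorem exists_smul_eq_of_smul_eq_smul {G : Type*} [AddCommGroup G] {n : ℕ} {m : ℤ}
    (hcop : IsCoprime (n : ℤ) m) {a x : G} (h : n • a = m • x) : ∃ y : G, n • y = x := by
  obtain ⟨u, v, huv⟩ := hcop
  refine ⟨u • x + v • a, ?_⟩
  rw [smul_add, smul_comm _ u, smul_comm _ v, h,
    ← natCast_zsmul, smul_smul, smul_smul, ← add_smul, huv, one_smul]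

/-- Between rank-1 groups there is an embedding with `x ↦ y` if `y` is divisible by all numbers
by which `x` is divisible. -/
theorem IsRankOne.exists_injective {T R : Type u} [AddCommGroup T] [AddCommGroup R]
    (hT : IsRankOne T) (hR : IsRankOne R) {x : T} {y : R} (hx : x ≠ 0) (hy : y ≠ 0)
    (h : ∀ p : Nat.Primes, pHeight p x ≤ pHeight p y) :
    ∃ f : T →ₗ[ℤ] R, Function.Injective f ∧ f x = y := by
  have := hT.torsionFree
  have := hR.torsionFree
  -- The image of `a` must satisfy the relation to `y` that `a` satisfies to `x`. In lowest terms
  -- the relation shows that `n` divides `x`, hence `y`.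
  have hex : ∀ a : T, ∃ (b : R) (n : ℕ) (m : ℤ), n ≠ 0 ∧ n • a = m • x ∧ n • b = m • y := by
    intro a
    obtain ⟨n, m, hn, hcop, ha⟩ := hT.exists_smul_eq_smul hx a
    obtain ⟨z, rfl⟩ := exists_smul_eq_of_prime_pow (y := y) hn (fun p k hp _ hz =>
      pow_dvd_of_le_pHeight ((le_pHeight hz).trans (h ⟨p, hp⟩)))
      (exists_smul_eq_of_smul_eq_smul hcop ha)
    exact ⟨m • z, n, m, hn, ha, smul_comm _ _ _⟩
  choose f n m hn ha hb using hex
  have huniq : ∀ (a : T) (b : R) (n' : ℕ) (m' : ℤ), n' ≠ 0 → n' • a = m' • x → n' • b = m' • y →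
      f a = b := by
    intro a b n' m' hn' ha' hb'
    have e : (n' : ℤ) * m a = n a * m' := by
      apply smul_left_injective ℤ hx
      show ((n' : ℤ) * m a) • x = ((n a : ℤ) * m') • x
      rw [mul_smul, mul_smul, ← ha, ← ha', natCast_zsmul, natCast_zsmul, smul_comm]
    apply IsAddTorsionFree.nsmul_right_injective (mul_ne_zero hn' (hn a))
    show (n' * n a) • f a = (n' * n a) • b
    rw [mul_smul, hb, mul_comm, mul_smul, hb', ← natCast_zsmul, ← natCast_zsmul, smul_smul,
      smul_smul, e]
  have hadd : ∀ a b, f (a + b) = f a + f b := by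
    intro a b
    refine huniq _ _ (n a * n b) (n b * m a + n a * m b) (mul_ne_zero (hn a) (hn b)) ?_ ?_
    · rw [smul_add, mul_smul (n a) (n b) b, ha b, mul_comm (n a), mul_smul, ha a, add_smul,
        mul_smul, mul_smul, natCast_zsmul, natCast_zsmul]
    · rw [smul_add, mul_smul (n a) (n b) (f b), hb b, mul_comm (n a), mul_smul, hb a, add_smul,
        mul_smul, mul_smul, natCast_zsmul, natCast_zsmul]
  refine ⟨(AddMonoidHom.mk' f hadd).toIntLinearMap, ?_, ?_⟩
  · refine (injective_iff_map_eq_zero _).mpr fun a (h0 : f a = 0) => ?_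
    have h1 := hb a
    rw [h0, smul_zero] at h1
    have h2 : m a = 0 := (smul_eq_zero.mp h1.symm).resolve_right hy
    have h3 := ha a
    rw [h2, zero_smul] at h3
    exact (smul_eq_zero.mp h3).resolve_left (hn a)
  · exact huniq x y 1 1 one_ne_zero (by simp) (by simp)

/-- The index of the image of an embedding with `x ↦ y` only involves primes at which the heights
of `x` and `y` differ; `A n` is any multiplicative property of numbers that holds
at these primes. -/
theorem IsRankOne.exists_smul_mem_range {T R : Type u} [AddCommGroup T] [AddCommGroup R]
    (hR : IsRankOne R) {x : T} {y : R} (hy : y ≠ 0) {f : T →ₗ[ℤ] R} (hf : f x = y)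
    {A : ℕ → Prop} (hA1 : A 1) (hA : ∀ m n, A m → A n → A (m * n))
    (h : ∀ p : Nat.Primes, ¬ A p → pHeight p y ≤ pHeight p x) (b : R) :
    ∃ n : ℕ, n ≠ 0 ∧ A n ∧ ∃ a : T, f a = n • b := by
  have := hR.torsionFree
  obtain ⟨n, m, hn, hcop, hb⟩ := hR.exists_smul_eq_smul hy b
  have hsplit : ∀ n : ℕ, n ≠ 0 → ∃ k l : ℕ, n = k * l ∧ A k ∧
      ∀ p : ℕ, p.Prime → p ∣ l → ¬ A p := by
    intro n
    induction n using induction_on_primes with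
    | zero => exact fun h => absurd rfl h
    | one => exact fun _ => ⟨1, 1, rfl, hA1, fun p hp h => absurd (Nat.dvd_one.mp h) hp.ne_one⟩
    | prime_mul p a hp ih =>
      intro hpa
      obtain ⟨k, l, rfl, hk, hl⟩ := ih (right_ne_zero_of_mul hpa)
      by_cases hAp : A p
      · exact ⟨p * k, l, (mul_assoc _ _ _).symm, hA _ _ hAp hk, hl⟩
      · refine ⟨k, p * l, mul_left_comm _ _ _, hk, fun s hs hsl => ?_⟩
        rcases (Nat.Prime.dvd_mul hs).mp hsl with h | h
        · rwa [(Nat.prime_dvd_prime_iff_eq hs hp).mp h]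
        · exact hl s hs h
  obtain ⟨k, l, rfl, hk, hl⟩ := hsplit n hn
  obtain ⟨z, hz⟩ := exists_smul_eq_of_smul_eq_smul hcop hb
  -- At the primes of `l` the height of `y` is at most that of `x`, so `l` divides `x` as it divides
  -- `y`. This cancels `l` from the relation for `b`.
  obtain ⟨w, rfl⟩ := exists_smul_eq_of_prime_pow (x := y) (y := x) (right_ne_zero_of_mul hn)
    (fun p k hp hpl hz => pow_dvd_of_le_pHeight ((le_pHeight hz).trans (h ⟨p, hp⟩ (hl p hp hpl))))
    ⟨k • z, by rw [← hz, mul_comm, mul_smul]⟩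
  refine ⟨k, left_ne_zero_of_mul hn, hk, m • w, ?_⟩
  apply IsAddTorsionFree.nsmul_right_injective (right_ne_zero_of_mul hn)
  show l • f (m • w) = l • k • b
  rw [smul_smul, mul_comm, hb, ← hf, map_zsmul, map_nsmul, smul_comm]

/-! ### Simultaneous congruences -/

theorem exists_extension_of_ker_le {A T Q : Type*} [AddCommGroup A] [AddCommGroup T]
    [AddCommGroup Q] (hQ : Module.Baer ℤ Q) (Φ : A →ₗ[ℤ] T) (Ψ : A →ₗ[ℤ] Q)
    (h : LinearMap.ker Φ ≤ LinearMap.ker Ψ) : ∃ φ : T →ₗ[ℤ] Q, φ ∘ₗ Φ = Ψ := by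
  have hinj : Function.Injective ((LinearMap.ker Φ).liftQ Φ le_rfl) :=
    LinearMap.ker_eq_bot.mp (Submodule.ker_liftQ_eq_bot _ _ _ le_rfl)
  obtain ⟨φ, hφ⟩ := hQ.extension_property _ hinj ((LinearMap.ker Φ).liftQ Ψ h)
  refine ⟨φ, LinearMap.ext fun a => ?_⟩
  simpa using LinearMap.congr_fun hφ (Submodule.Quotient.mk a)

/-- If elements `z p` of a torsion-free group satisfy `p • z p = x ≠ 0` for distinct primes `p`,
then in each linear relation between them the coefficient of `z p` is divisible by `p`. -/
theorem dvd_of_linearCombination_eq_zero {T : Type*} [AddCommGroup T] [IsAddTorsionFree T] {x : T}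
    (hx : x ≠ 0) {S : Set Nat.Primes} {z : S → T} (hz : ∀ p : S, (p.1 : ℕ) • z p = x)
    {c : S →₀ ℤ} (hc : Finsupp.linearCombination ℤ z c = 0) (p : S) : ((p.1 : ℕ) : ℤ) ∣ c p := by
  classical
  set s := c.support.erase p
  set N : ℕ := ∏ l ∈ s, ((l : Nat.Primes) : ℕ)
  have hp : Nat.Prime p.1 := p.1.2
  have hN : ¬ (p.1 : ℕ) ∣ N := by
    intro h
    obtain ⟨l, hl, hpl⟩ := (Prime.dvd_finsetProd_iff hp.prime _).mp h
    have : (p.1 : ℕ) = l.1 := (Nat.prime_dvd_prime_iff_eq hp l.1.2).mp hpl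
    exact (Finset.ne_of_mem_erase hl) (Subtype.ext (Subtype.ext this.symm))
  -- `N` clears the other primes, and `x = p • z p`; the relation becomes `N c_p + M p = 0` with `p
  -- ∤ N`.
  obtain ⟨M, hM⟩ : ∃ M : ℤ, N • ∑ l ∈ s, c l • z l = M • x := by
    refine ⟨∑ l ∈ s, c l * ∏ j ∈ s.erase l, ((j : Nat.Primes) : ℕ), ?_⟩
    rw [Finset.smul_sum, Finset.sum_smul]
    refine Finset.sum_congr rfl fun l hl => ?_
    have : N = (∏ j ∈ s.erase l, ((j : Nat.Primes) : ℕ)) * l.1 :=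
      (Finset.prod_erase_mul s (fun j : S => ((j : Nat.Primes) : ℕ)) hl).symm
    rw [smul_comm, this, mul_smul, hz, mul_smul, natCast_zsmul]
  have hsum : c p • z p + ∑ l ∈ s, c l • z l = 0 := by
    rw [← hc, Finsupp.linearCombination_apply, Finsupp.sum]
    by_cases hps : p ∈ c.support
    · exact Finset.add_sum_erase _ (fun l => c l • z l) hps
    · rw [Finsupp.notMem_support_iff.mp hps, zero_smul, zero_add,
        show s = c.support from Finset.erase_eq_of_notMem hps]
  have hzp : z p ≠ 0 := by
    intro h
    exact hx (by rw [← hz p, h, smul_zero])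
  have h0 : ((N : ℤ) * c p + M * (p.1 : ℕ)) • z p = 0 := by
    have := congrArg (N • ·) hsum
    simp only [smul_add, smul_zero, hM] at this
    rw [← this, add_smul, mul_smul, mul_smul, natCast_zsmul, natCast_zsmul, hz]
  have h1 := (smul_eq_zero.mp h0).resolve_right hzp
  have h2 : ((p.1 : ℕ) : ℤ) ∣ (N : ℤ) * c p := ⟨-M, by linear_combination h1⟩
  exact (Nat.prime_iff_prime_int.mp hp).dvd_or_dvd h2 |>.resolve_left
    fun h => hN (Int.natCast_dvd_natCast.mp h)

/-- If `Ext(T, G)` vanishes and `x ∈ T` is divisible by all primes in `S`, then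
`G → ∏_{p ∈ S} G ⧸ pG` is surjective. -/
theorem LiftsAlong.exists_simultaneous_congruence {T D Q : Type*} [AddCommGroup T]
    [IsAddTorsionFree T] [AddCommGroup D] [AddCommGroup Q] {q : D →ₗ[ℤ] Q}
    (hD : Module.Baer ℤ D) (hQ : Module.Baer ℤ Q) (h : LiftsAlong T q) {x : T} (hx : x ≠ 0)
    {S : Set Nat.Primes} (hS : ∀ p ∈ S, ∃ z : T, (p : ℕ) • z = x)
    (g : S → LinearMap.ker q) :
    ∃ g₀ : LinearMap.ker q, ∀ p : S, ∃ h : LinearMap.ker q, (p.1 : ℕ) • h = g₀ - g p := by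
  rcases S.eq_empty_or_nonempty with rfl | ⟨p₀, hp₀⟩
  · exact ⟨0, fun p => p.2.elim⟩
  obtain ⟨z, hz⟩ : ∃ z : S → T, ∀ p : S, (p.1 : ℕ) • z p = x :=
    Classical.skolem.mp fun p : S => hS p p.2
  choose d hd using fun p : S => exists_smul_eq_of_baer hD
    (n := ((p.1 : ℕ) : ℤ)) (by exact_mod_cast p.1.2.ne_zero) (g p : D)
  have hqd : ∀ p : S, ((p.1 : ℕ) : ℤ) • q (d p) = 0 := fun p => by
    rw [← map_zsmul, hd]
    exact (g p).2
  -- The assignment `z p ↦ q (d p)` respects all relations, because `p` kills `q (d p)` and divides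
  -- the coefficient of `z p`. If `ψ` lifts its extension `φ`, then `ψ x` is the required `g₀`.
  obtain ⟨φ, hφ⟩ := exists_extension_of_ker_le hQ (Finsupp.linearCombination ℤ z)
    (Finsupp.linearCombination ℤ fun p => q (d p)) fun c hc => by
      rw [LinearMap.mem_ker, Finsupp.linearCombination_apply]
      refine Finset.sum_eq_zero fun p _ => ?_
      obtain ⟨k, hk⟩ := dvd_of_linearCombination_eq_zero hx hz hc p
      show c p • q (d p) = 0
      rw [hk, mul_comm, mul_smul, hqd, smul_zero]
  have hφz : ∀ p : S, φ (z p) = q (d p) := fun p => by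
    simpa using LinearMap.congr_fun hφ (Finsupp.single p 1)
  obtain ⟨ψ, hψ⟩ := h φ
  have hψφ : ∀ a, q (ψ a) = φ a := fun a => LinearMap.congr_fun hψ a
  have hxker : ψ x ∈ LinearMap.ker q := by
    rw [LinearMap.mem_ker, hψφ, ← hz ⟨p₀, hp₀⟩, map_nsmul, hφz, ← natCast_zsmul]
    exact hqd ⟨p₀, hp₀⟩
  refine ⟨⟨ψ x, hxker⟩, fun p => ⟨⟨ψ (z p) - d p, ?_⟩, Subtype.ext ?_⟩⟩
  · rw [LinearMap.mem_ker, map_sub, hψφ, hφz, sub_self]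
  · show (p.1 : ℕ) • (ψ (z p) - d p) = ψ x - g p
    rw [smul_sub, ← map_nsmul, hz, ← hd, natCast_zsmul]

/-! ### The diagonal argument -/

/-- A group of finite torsion-free rank is countable modulo torsion. -/
theorem exists_nat_representatives {G : Type u} [AddCommGroup G]
    (hG : Module.rank ℤ G < Cardinal.aleph0) :
    ∃ a : ℕ → G, ∀ g : G, ∃ (i n : ℕ), n ≠ 0 ∧ n • (g - a i) = 0 := by
  obtain ⟨s, hs, hli⟩ := exists_set_linearIndependent ℤ G
  have hsfin : s.Finite := by
    rw [← Cardinal.lt_aleph0_iff_set_finite, hs]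
    exact hG
  have hrank : Module.rank ℤ (G ⧸ Submodule.span ℤ s) = 0 := by
    have h1 := HasRankNullity.rank_quotient_add_rank (Submodule.span ℤ s)
    rw [rank_span_set hli, hs] at h1
    exact Cardinal.eq_of_add_eq_add_right (h1.trans (zero_add _).symm) hG
  have hfg : Module.Finite ℤ (Submodule.span ℤ s) := Module.Finite.span_of_finite ℤ hsfin
  have hct : Countable (Submodule.span ℤ s) := by
    obtain ⟨n, f, hf⟩ := Module.Finite.exists_fin' ℤ (Submodule.span ℤ s)
    exact hf.countable
  -- One solution of `n • a = v` for each of the countably many pairs `(n, v)` suffices, since two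
  -- solutions differ by torsion; the value `0` is a dummy where there is none.
  have hex : ∀ i : ℕ × Submodule.span ℤ s, ∃ a : G, (∃ b : G, i.1 • b = i.2) → i.1 • a = i.2 := by
    intro i
    by_cases h : ∃ b : G, i.1 • b = i.2
    · exact ⟨h.choose, fun _ => h.choose_spec⟩
    · exact ⟨0, fun h' => absurd h' h⟩
  choose a ha using hex
  obtain ⟨e, he⟩ := exists_surjective_nat (ℕ × Submodule.span ℤ s)
  refine ⟨a ∘ e, fun g => ?_⟩
  obtain ⟨n, hn, hng⟩ : ∃ n : ℕ, n ≠ 0 ∧ n • g ∈ Submodule.span ℤ s := by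
    obtain ⟨n, hn, h⟩ := rank_eq_zero_iff.mp hrank (Submodule.Quotient.mk g)
    rw [← Submodule.Quotient.mk_smul, Submodule.Quotient.mk_eq_zero] at h
    refine ⟨n.natAbs, Int.natAbs_ne_zero.mpr hn, ?_⟩
    rw [← natCast_zsmul]
    rcases Int.natAbs_eq n with h' | h'
    · rwa [← h']
    · rw [← neg_eq_iff_eq_neg.mpr h', neg_smul]
      exact neg_mem h
  obtain ⟨i, hi⟩ := he (n, ⟨n • g, hng⟩)
  refine ⟨i, n, hn, ?_⟩
  have := ha (n, ⟨n • g, hng⟩) ⟨g, rfl⟩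
  rw [Function.comp_apply, hi, smul_sub, this, sub_self]

/-- Diagonal argument: for a group `G` of finite torsion-free rank, the map from `G` to an infinite
product of nonzero groups `G ⧸ pG` is not surjective. -/
theorem finite_of_simultaneous_congruence {G : Type u} [AddCommGroup G]
    (hG : Module.rank ℤ G < Cardinal.aleph0) {S : Set Nat.Primes}
    (hS : ∀ p ∈ S, ¬ IsDivisibleBy G p)
    (h : ∀ g : S → G, ∃ g₀ : G, ∀ p : S, ∃ k : G, (p.1 : ℕ) • k = g₀ - g p) : S.Finite := by
  by_contra hinf
  have : Infinite S := Set.infinite_coe_iff.mpr hinf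
  obtain ⟨a, ha⟩ := exists_nat_representatives hG
  -- The pairing assigns infinitely many primes of `S` to each representative `a i`; at these, `g`
  -- is chosen to differ from `a i` modulo `p`.
  let e : S → ℕ × ℕ := fun p => Nat.unpair (Function.invFun (Infinite.natEmbedding S) p)
  have he : ∀ i j : ℕ, ∃ p : S, e p = (i, j) ∧ Infinite.natEmbedding S (Nat.pair i j) = p := by
    intro i j
    refine ⟨_, ?_, rfl⟩
    simp only [e]
    rw [Function.leftInverse_invFun (Infinite.natEmbedding S).injective, Nat.unpair_pair]
  have hex : ∀ p : S, ∃ g : G, ¬ ∃ k : G, (p.1 : ℕ) • k = a (e p).1 - g := by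
    intro p
    obtain ⟨b, hb⟩ := not_forall.mp (hS p p.2)
    by_contra! hcon
    obtain ⟨k, hk⟩ := hcon 0
    obtain ⟨l, hl⟩ := hcon b
    refine hb ⟨k - l, ?_⟩
    show (p.1 : ℕ) • (k - l) = b
    rw [smul_sub, hk, hl]
    abel
  choose g hg using hex
  obtain ⟨g₀, hg₀⟩ := h g
  obtain ⟨i, n, hn, hni⟩ := ha g₀
  -- At a prime `p ∤ n` the torsion element `g₀ - a i` lies in `pG`, so `g p` would agree with `a i`
  -- modulo `p`.
  obtain ⟨j, hj⟩ : ∃ j : ℕ, ¬ ((Infinite.natEmbedding S (Nat.pair i j)).1 : ℕ) ∣ n := by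
    by_contra! hcon
    have hinj : Function.Injective
        fun j => ((Infinite.natEmbedding S (Nat.pair i j)).1 : ℕ) := by
      intro j j' hjj
      have := (Infinite.natEmbedding S).injective (Subtype.ext (Subtype.ext hjj))
      exact (Nat.pair_eq_pair.mp this).2
    refine Set.infinite_range_of_injective hinj ((Finset.finite_toSet n.divisors).subset ?_)
    rintro _ ⟨j, rfl⟩
    simpa [hn] using hcon j
  obtain ⟨p, hp, rfl⟩ := he i j
  set p := Infinite.natEmbedding S (Nat.pair i j)
  obtain ⟨k, hk⟩ := hg₀ p
  obtain ⟨u, v, huv⟩ : IsCoprime ((p.1 : ℕ) : ℤ) (n : ℤ) :=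
    Nat.isCoprime_iff_coprime.mpr ((Nat.Prime.coprime_iff_not_dvd p.1.2).mpr hj)
  refine hg p ⟨k - u • (g₀ - a i), ?_⟩
  have hτ : (p.1 : ℕ) • u • (g₀ - a i) = g₀ - a i := by
    have hni' : (n : ℤ) • (g₀ - a i) = 0 := by rw [natCast_zsmul, hni]
    calc (p.1 : ℕ) • u • (g₀ - a i) = (u * (p.1 : ℕ)) • (g₀ - a i) + v • ((n : ℤ) • (g₀ - a i)) := by
          rw [hni', smul_zero, add_zero, mul_smul, natCast_zsmul, smul_comm]
      _ = g₀ - a i := by rw [smul_smul, ← add_smul, huv, one_smul]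
  rw [smul_sub, hk, hτ, hp]
  abel

/-! ### Comparison of the two groups -/

/-- Elements whose characteristics are comparable off a finite set of primes, and finite on it,
have nonzero multiples whose characteristics agree on this set and are unchanged off it. -/
theorem exists_multiples_pHeight_eq {T R : Type u} [AddCommGroup T] [AddCommGroup R]
    [IsAddTorsionFree T] [IsAddTorsionFree R] {x : T} {y : R} (hx : x ≠ 0) (hy : y ≠ 0)
    {F : Set Nat.Primes} (hF : F.Finite)
    (hfin : ∀ p ∈ F, pHeight p x ≠ ⊤ ∧ pHeight p y ≠ ⊤) :
    ∃ (x' : T) (y' : R), x' ≠ 0 ∧ y' ≠ 0 ∧ (∀ p ∈ F, pHeight p x' = pHeight p y') ∧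
      ∀ p ∉ F, pHeight p x' = pHeight p x ∧ pHeight p y' = pHeight p y := by
  -- Each height is raised by the other one, so both become the sum.
  obtain ⟨x', hx', hx1, hx2⟩ :=
    exists_ne_zero_pHeight_eq_add hx hF.toFinset fun p => (pHeight p y).toNat
  obtain ⟨y', hy', hy1, hy2⟩ :=
    exists_ne_zero_pHeight_eq_add hy hF.toFinset fun p => (pHeight p x).toNat
  simp only [Set.Finite.mem_toFinset] at hx1 hx2 hy1 hy2
  refine ⟨x', y', hx', hy', fun p hp => ?_, fun p hp => ⟨hx2 p hp, hy2 p hp⟩⟩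
  rw [hx1 p hp, hy1 p hp, ENat.natCast_toNat (hfin p hp).1, ENat.natCast_toNat (hfin p hp).2, add_comm]

/-- A rank-1 group of smaller type embeds into one of larger type. -/
theorem IsRankOne.exists_injective_of_le {T R : Type u} [AddCommGroup T] [AddCommGroup R]
    (hT : IsRankOne T) (hR : IsRankOne R) (h : typeOf T hT ≤ typeOf R hR) :
    ∃ f : T →ₗ[ℤ] R, Function.Injective f := by
  have := hT.torsionFree
  have := hR.torsionFree
  obtain ⟨x, hx⟩ := hT.exists_ne_zero
  obtain ⟨y, hy⟩ := hR.exists_ne_zero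
  obtain ⟨t, r, ht, hr, htr⟩ := h
  rw [typeOf_eq hT hx, GroupType.mk_eq_mk] at ht
  rw [typeOf_eq hR hy, GroupType.mk_eq_mk] at hr
  have key : ∀ p : Nat.Primes, pHeight p y < pHeight p x →
      t p ≠ characteristic x p ∨ r p ≠ characteristic y p := by
    intro p hp
    by_contra! hcon
    exact hp.not_ge (hcon.1.ge.trans ((htr p).trans hcon.2.le))
  obtain ⟨x', y', hx', hy', h1, h2⟩ := exists_multiples_pHeight_eq hx hy
    (F := {p | pHeight p y < pHeight p x}) ((ht.1.union hr.1).subset key) fun p hp => by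
      refine ⟨fun htop => ?_, (lt_of_lt_of_le hp le_top).ne⟩
      have htp : t p = ⊤ := by
        by_contra hne
        exact (ht.2 p fun e => hne (e.trans htop)).2 htop
      have hrp : r p = ⊤ := top_le_iff.mp (htp ▸ htr p)
      have hrp' : r p ≠ characteristic y p := fun e =>
        (lt_of_lt_of_le hp le_top).ne (e.symm.trans hrp)
      exact (hr.2 p hrp').1 hrp
  obtain ⟨f, hf, -⟩ := hT.exists_injective hR hx' hy' fun p => by
    by_cases hp : pHeight p y < pHeight p x
    · exact (h1 p hp).le
    · rw [(h2 p hp).1, (h2 p hp).2]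
      exact not_lt.mp hp
  exact ⟨f, hf⟩

/-- Let `T` and `R` be rank-1 groups whose characteristics differ essentially only at primes where
both are nonzero and finite. For a group `G = ker q` of finite torsion-free rank,
the vanishing of `Ext(T, G)` implies that of `Ext(R, G)`. -/
theorem LiftsAlong.of_rank_lt_aleph0 {T R D Q : Type u} [AddCommGroup T] [AddCommGroup R]
    [AddCommGroup D] [AddCommGroup Q] {q : D →ₗ[ℤ] Q} (hq : Function.Surjective q)
    (hD : Module.Baer ℤ D) (hG : Module.rank ℤ (LinearMap.ker q) < Cardinal.aleph0)
    (hT : IsRankOne T) (hR : IsRankOne R) {t r : Characteristic}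
    (ht : typeOf T hT = GroupType.mk t) (hr : typeOf R hR = GroupType.mk r)
    (htr : ∀ p, t p ≤ r p) (htop : ∀ p, r p = ⊤ → t p = ⊤)
    (hzero : {p | t p = 0 ∧ r p ≠ 0}.Finite) (h : LiftsAlong T q) : LiftsAlong R q := by
  have := hT.torsionFree
  have := hR.torsionFree
  obtain ⟨x, hx⟩ := hT.exists_ne_zero
  obtain ⟨y, hy⟩ := hR.exists_ne_zero
  rw [typeOf_eq hT hx, GroupType.mk_eq_mk] at ht
  rw [typeOf_eq hR hy, GroupType.mk_eq_mk] at hr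
  have hxt : ∀ p : Nat.Primes, pHeight p x = ⊤ ↔ t p = ⊤ := by
    intro p
    have := ht.2 p
    by_cases he : characteristic x p = t p
    · rw [← he]; rfl
    · exact ⟨fun e => absurd e (this he).1, fun e => absurd e (this he).2⟩
  have hyr : ∀ p : Nat.Primes, pHeight p y = ⊤ ↔ r p = ⊤ := by
    intro p
    have := hr.2 p
    by_cases he : characteristic y p = r p
    · rw [← he]; rfl
    · exact ⟨fun e => absurd e (this he).1, fun e => absurd e (this he).2⟩
  have hxy : ∀ p : Nat.Primes, pHeight p x = ⊤ ↔ pHeight p y = ⊤ := fun p => by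
    rw [hxt, hyr]
    exact ⟨fun e => top_le_iff.mp (e ▸ htr p), htop p⟩
  have hSfin : {p : Nat.Primes | (∃ z : T, (p : ℕ) • z = x) ∧
      ¬ IsDivisibleBy (LinearMap.ker q) p}.Finite :=
    finite_of_simultaneous_congruence hG (fun p hp => hp.2) fun g =>
      h.exists_simultaneous_congruence hD (baer_of_surjective hD hq) hx (fun p hp => hp.1) g
  -- The primes needing adjustment: those that obstruct an embedding `x ↦ y`, and those that may
  -- enter its index although `G` is not `p`-divisible.
  let F : Set Nat.Primes := {p | pHeight p y < pHeight p x ∨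
    pHeight p x ≠ pHeight p y ∧ ¬ IsDivisibleBy (LinearMap.ker q) p}
  have hFfin : F.Finite := by
    -- Where the heights equal `t p ≤ r p`, membership in `F` makes them differ with `G` not
    -- `p`-divisible. Off the finite set `t p = 0 ≠ r p` this gives `t p ≠ 0`, so `p` divides `x`
    -- and lies in the finite set of `hSfin`.
    refine (((ht.1.union hr.1).union hzero).union hSfin).subset fun p hp => ?_
    by_contra hcon
    simp only [Set.mem_union, Set.mem_ofPred_eq, not_or, not_not] at hcon
    obtain ⟨⟨⟨hxp, hyp⟩, hz⟩, hS⟩ := hcon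
    change pHeight p x = t p at hxp
    change pHeight p y = r p at hyp
    rcases hp with hp | ⟨hne, hdiv⟩
    · exact hp.not_ge (hxp ▸ hyp ▸ htr p)
    · have ht0 : t p ≠ 0 := by
        intro h0
        exact hz ⟨h0, fun h0' => hne (by rw [hxp, hyp, h0, h0'])⟩
      refine hS ⟨?_, hdiv⟩
      have h1 : ((1 : ℕ) : ℕ∞) ≤ pHeight p x := by
        rw [hxp, Nat.cast_one]
        exact Order.one_le_iff_ne_zero.mpr ht0
      simpa using pow_dvd_of_le_pHeight h1
  obtain ⟨x', y', hx', hy', h1, h2⟩ := exists_multiples_pHeight_eq hx hy hFfin fun p hp => by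
    have hne : pHeight p x ≠ pHeight p y := by
      rcases hp with hp | hp
      · exact hp.ne'
      · exact hp.1
    exact ⟨fun e => hne (e.trans ((hxy p).mp e).symm),
      fun e => hne (((hxy p).mpr e).trans e.symm)⟩
  obtain ⟨f, hf, hfx⟩ := hT.exists_injective hR hx' hy' fun p => by
    by_cases hp : p ∈ F
    · exact (h1 p hp).le
    · rw [(h2 p hp).1, (h2 p hp).2]
      exact not_lt.mp fun hlt => hp (Or.inl hlt)
  refine h.of_divisible_index hq hD hf (hR.exists_smul_mem_range hy' hfx
    (fun g => ⟨g, one_smul _ g⟩) (fun m n => IsDivisibleBy.mul) fun p hdiv => ?_)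
  by_cases hp : p ∈ F
  · exact (h1 p hp).ge
  · rw [(h2 p hp).1, (h2 p hp).2]
    by_contra hlt
    exact hp (Or.inr ⟨fun e => hlt e.ge, hdiv⟩)

/-- The vanishing of `Ext(T, G)` and `Ext(R, G)` is equivalent for groups `G` of finite
torsion-free rank. -/
theorem mem_perp_iff_of_rank_lt_aleph0 {T R : ModuleCat.{u} ℤ} (hT : IsRankOne T)
    (hR : IsRankOne R) {t r : Characteristic}
    (ht : typeOf T hT = GroupType.mk t) (hr : typeOf R hR = GroupType.mk r)
    (htr : ∀ p, t p ≤ r p) (htop : ∀ p, r p = ⊤ → t p = ⊤)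
    (hzero : {p | t p = 0 ∧ r p ≠ 0}.Finite) {G : ModuleCat.{u} ℤ}
    (hG : Module.rank ℤ G < Cardinal.aleph0) : G ∈ perp T ↔ G ∈ perp R := by
  obtain ⟨D, Q, _, _, q, hq, hD, ⟨e⟩, hperp⟩ := exists_injective_presentation G
  rw [hperp, hperp]
  constructor
  · refine LiftsAlong.of_rank_lt_aleph0 hq hD ?_ hT hR ht hr htr htop hzero
    obtain @⟨G, gG, iG⟩ := G
    obtain rfl : iG = AddCommGroup.toIntModule G := Subsingleton.elim _ _
    exact e.toIntLinearEquiv.rank_eq ▸ hG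
  · obtain ⟨f, hf⟩ := hT.exists_injective_of_le hR ⟨t, r, ht.symm, hr.symm, htr⟩
    exact LiftsAlong.of_injective (baer_of_surjective hD hq) hf

end RationalGroups

theorem proposition1p8 (T R : ModuleCat.{u} ℤ)
    (hT : RationalGroups.IsRankOne T) (hR : RationalGroups.IsRankOne R)
    (t r : RationalGroups.Characteristic)
    (ht : RationalGroups.typeOf T hT = RationalGroups.GroupType.mk t)
    (hr : RationalGroups.typeOf R hR = RationalGroups.GroupType.mk r)
    (htr : ∀ p, t p ≤ r p)
    (hlt : RationalGroups.typeOf T hT < RationalGroups.typeOf R hR)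
    (h2b : ∃ P : Set Nat.Primes, P.Infinite ∧ ∀ p ∈ P, 0 < t p ∧ t p < r p ∧ r p < ⊤)
    (h1 : ¬ ∃ q : Nat.Primes, t q < ⊤ ∧ r q = ⊤)
    (h2a : ¬ ∃ P : Set Nat.Primes, P.Infinite ∧ ∀ p ∈ P, t p = 0 ∧ r p ≠ 0 ∧ r p < ⊤) :
    RationalGroups.perp T ∩ RationalGroups.finiteRankTorsionFree =
        RationalGroups.perp R ∩ RationalGroups.finiteRankTorsionFree ∧
      ∀ G : ModuleCat.{u} ℤ,
        ((G ∈ RationalGroups.perp T ∧ G ∉ RationalGroups.perp R) ∨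
          (G ∈ RationalGroups.perp R ∧ G ∉ RationalGroups.perp T)) →
        Cardinal.aleph0 ≤ Module.rank ℤ G := by
  have htop : ∀ p, r p = ⊤ → t p = ⊤ := fun p hp => by
    by_contra hne
    exact h1 ⟨p, lt_top_iff_ne_top.mpr hne, hp⟩
  -- Here `r p = ∞` cannot occur, as it would force `t p = ∞`; so the failure of (2a) applies.
  have hzero : {p | t p = 0 ∧ r p ≠ 0}.Finite := by
    by_contra hinf
    refine h2a ⟨_, hinf, fun p hp => ⟨hp.1, hp.2, lt_top_iff_ne_top.mpr fun hrp => ?_⟩⟩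
    exact ENat.top_ne_zero ((htop p hrp).symm.trans hp.1)
  have key : ∀ G : ModuleCat.{u} ℤ, Module.rank ℤ G < Cardinal.aleph0 →
      (G ∈ RationalGroups.perp T ↔ G ∈ RationalGroups.perp R) := fun G hG =>
    RationalGroups.mem_perp_iff_of_rank_lt_aleph0 hT hR ht hr htr htop hzero hG
  refine ⟨Set.ext fun G => and_congr_left fun hG => key G hG.2, fun G hG => ?_⟩
  by_contra hlt'
  have := key G (not_le.mp hlt')
  tauto
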